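/- All graphs are finite, simple and undirected. The middle graph $M(G)$ of a graph $G$ has vertex set $V(G)\sqcup E(G)$; a vertex $v\in V(G)$ is adjacent to an edge $e\in E(G)$ exactly when $v$ is an end of $e$, two distinct edges $e,f\in E(G)$ are adjacent exactly when they share an end, and no two vertices of $V(G)$ are adjacent. For a graph $H$, the distinguishing number $D(H)$ (respectively, the distinguishing index $D'(H)$) is the least integer $d$ such that $H$ has a vertex coloring (respectively, an edge coloring) with $d$ colors, not necessarily proper, that is preserved by no automorphism of $H$ other than the identity; it is $\infty$ if there is no such $d$. Let $\Delta(G)$ denote the maximum degree of $G$. Theorem. Let $G$ be a connected graph of order $n$. 1. If $n\ge 3$, then $D(M(G))\le \Delta(G)$. This bound is sharp: for every $n\ge 3$ there is a connected graph $H$ of order $n$ with $D(M(H))=\Delta(H)$. 2. For every positive integer $n$, $D'(M(G))\le 3$. -/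

import Mathlib

/-- The middle graph of `G`: its vertices are the vertices of `G` together with one subdividing
vertex for each edge of `G`. A subdividing vertex is joined to the two ends of its edge, and two
subdividing vertices are joined when they lie on adjacent (distinct, sharing an end) edges. -/
def middleGraph {V : Type*} (G : SimpleGraph V) : SimpleGraph (V ⊕ G.edgeSet) where
  Adj x y :=
    match x, y with
    | .inl _, .inl _ => False
    | .inl v, .inr e => v ∈ (e : Sym2 V)
    | .inr e, .inl v => v ∈ (e : Sym2 V)
    | .inr e, .inr f => e ≠ f ∧ ∃ v, v ∈ (e : Sym2 V) ∧ v ∈ (f : Sym2 V)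
  symm := ⟨by
    rintro (v | e) (w | f) h
    · exact h
    · exact h
    · exact h
    · exact ⟨h.1.symm, h.2.imp fun _ hv => hv.symm⟩⟩
  loopless := ⟨by
    rintro (v | e) h
    · exact h
    · exact h.1 rfl⟩

/-- A vertex coloring is distinguishing if the identity is the only automorphism preserving it. -/
def IsDistinguishingColoring {V α : Type*} (G : SimpleGraph V) (c : V → α) : Prop :=
  ∀ φ : G ≃g G, (∀ v, c (φ v) = c v) → φ = SimpleGraph.Iso.refl

/-- An edge coloring is distinguishing if the identity is the only automorphism preserving it. -/
def IsDistinguishingEdgeColoring {V α : Type*} (G : SimpleGraph V) (c : G.edgeSet → α) : Prop :=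
  ∀ φ : G ≃g G, (∀ e, c (φ.mapEdgeSet e) = c e) → φ = SimpleGraph.Iso.refl

/-- The distinguishing number: the least `d` such that some vertex coloring with `d` colors is
distinguishing (`⊤` if there is no such `d`). -/
noncomputable def distinguishingNumber {V : Type*} (G : SimpleGraph V) : ℕ∞ :=
  ⨅ d ∈ {d : ℕ | ∃ c : V → Fin d, IsDistinguishingColoring G c}, (d : ℕ∞)

/-- The distinguishing index: the least `d` such that some edge coloring with `d` colors is
distinguishing (`⊤` if there is no such `d`). -/
noncomputable def distinguishingIndex {V : Type*} (G : SimpleGraph V) : ℕ∞ :=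
  ⨅ d ∈ {d : ℕ | ∃ c : G.edgeSet → Fin d, IsDistinguishingEdgeColoring G c}, (d : ℕ∞)

/-! The vertices of `G` are exactly the simplicial vertices of its middle graph, so every
automorphism of the latter is induced by one of `G` (`middleGraphIso_surjective`), and a coloring
need only rule out nontrivial automorphisms σ of `G`. Root `G` at `r` and take a breadth first
search tree. If σ fixes `r`, then by induction on the distance it is trivial once it fixes all
children of each fixed vertex (`eq_of_fixes_children`). For vertex colorings, edges of `G` mark a
root of degree at least 2, and neighbors of a common parent get distinct colors. For edge colorings,
one color marks the root, and another draws a path through the edges to the children of each vertex,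
with a tag on the first child. -/

open SimpleGraph

/-! ### Automorphisms of the middle graph -/

section MiddleGraph

variable {V : Type*} {G : SimpleGraph V}

@[simp] lemma middleGraph_not_adj_inl_inl {u v : V} : ¬ (middleGraph G).Adj (.inl u) (.inl v) :=
  id

@[simp] lemma middleGraph_adj_inl_inr {v : V} {e : G.edgeSet} :
    (middleGraph G).Adj (.inl v) (.inr e) ↔ v ∈ (e : Sym2 V) := Iff.rfl

@[simp] lemma middleGraph_adj_inr_inl {v : V} {e : G.edgeSet} :
    (middleGraph G).Adj (.inr e) (.inl v) ↔ v ∈ (e : Sym2 V) := Iff.rfl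

/-- The vertices of `G` are the simplicial vertices of its middle graph. -/
lemma middleGraph_simplicial_iff {x : V ⊕ G.edgeSet} :
    (∀ y z, (middleGraph G).Adj x y → (middleGraph G).Adj x z → y ≠ z → (middleGraph G).Adj y z) ↔
      ∃ v, x = .inl v := by
  constructor
  · intro h
    rcases x with v | ⟨e, he⟩
    · exact ⟨v, rfl⟩
    · induction e with | _ a b
      have hab : a ≠ b := G.ne_of_adj he
      -- The two ends of an edge are nonadjacent neighbors of its subdividing vertex.
      exact absurd (h (.inl a) (.inl b) (by simp) (by simp) (by simpa using hab)) (by simp)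
  · rintro ⟨v, rfl⟩ (a | e) (b | f) hy hz hne
    · simp at hy
    · simp at hy
    · simp at hz
    · exact ⟨fun h => hne (by rw [h]), v, hy, hz⟩

lemma middleGraph_iso_apply_inl (φ : middleGraph G ≃g middleGraph G) (v : V) :
    ∃ w, φ (.inl v) = .inl w := by
  rw [← middleGraph_simplicial_iff]
  intro y z hy hz hne
  obtain ⟨y, rfl⟩ := φ.surjective y
  obtain ⟨z, rfl⟩ := φ.surjective z
  rw [φ.map_adj_iff] at hy hz ⊢
  exact middleGraph_simplicial_iff.2 ⟨v, rfl⟩ y z hy hz fun h => hne (by rw [h])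

/-- An automorphism of a graph acts on its middle graph. -/
def middleGraphIso (σ : G ≃g G) : middleGraph G ≃g middleGraph G where
  toEquiv := Equiv.sumCongr σ.toEquiv σ.mapEdgeSet
  map_rel_iff' := by
    have key : ∀ (v : V) (e : Sym2 V), σ v ∈ e.map σ ↔ v ∈ e := fun v e => by
      simp [Sym2.mem_map, σ.injective.eq_iff]
    rintro (u | ⟨e, he⟩) (v | ⟨f, hf⟩)
    · exact Iff.rfl
    · exact key u f
    · exact key v e
    · refine and_congr (not_congr σ.mapEdgeSet.apply_eq_iff_eq) ?_
      rw [← σ.surjective.exists.symm]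
      exact exists_congr fun v => and_congr (key v e) (key v f)

@[simp] lemma middleGraphIso_inl (σ : G ≃g G) (v : V) :
    middleGraphIso σ (.inl v) = .inl (σ v) := rfl

@[simp] lemma middleGraphIso_inr (σ : G ≃g G) (e : G.edgeSet) :
    middleGraphIso σ (.inr e) = .inr (σ.mapEdgeSet e) := rfl

lemma coe_mapEdgeSet (σ : G ≃g G) (e : G.edgeSet) :
    (σ.mapEdgeSet e : Sym2 V) = (e : Sym2 V).map σ := rfl

/-- Every automorphism of the middle graph comes from an automorphism of the graph. -/
lemma middleGraphIso_surjective :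
    Function.Surjective (middleGraphIso : (G ≃g G) → (middleGraph G ≃g middleGraph G)) := by
  intro φ
  choose f hf using middleGraph_iso_apply_inl φ
  choose g hg using middleGraph_iso_apply_inl φ.symm
  have hgf : ∀ v, g (f v) = v := fun v => by
    have := hg (f v)
    rw [← hf v, φ.symm_apply_apply] at this
    exact (Sum.inl.inj this).symm
  have hfg : ∀ v, f (g v) = v := fun v => by
    have := hf (g v)
    rw [← hg v, φ.apply_symm_apply] at this
    exact (Sum.inl.inj this).symm
  have hinr : ∀ e : G.edgeSet, ∃ e' : G.edgeSet, φ (.inr e) = .inr e' := by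
    intro e
    rcases h : φ (.inr e) with w | e'
    · have := hg w
      rw [← h, φ.symm_apply_apply] at this
      cases this
    · exact ⟨e', rfl⟩
  choose h hh using hinr
  have hmem : ∀ v e, f v ∈ (h e : Sym2 V) ↔ v ∈ (e : Sym2 V) := by
    intro v e
    rw [← middleGraph_adj_inl_inr, ← hf, ← hh, φ.map_adj_iff, middleGraph_adj_inl_inr]
  have hmap : ∀ e, (h e : Sym2 V) = (e : Sym2 V).map f := by
    intro e
    ext w
    rw [← hfg w, hmem, Sym2.mem_map]
    exact ⟨fun hw => ⟨_, hw, rfl⟩, fun ⟨a, ha, haw⟩ => by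
      rw [← hgf a, haw, hgf] at ha; exact ha⟩
  have hadj : ∀ u v, G.Adj u v → G.Adj (f u) (f v) := by
    intro u v huv
    have := (h ⟨s(u, v), huv⟩).2
    rwa [hmap, Sym2.map_mk] at this
  have hadj' : ∀ u v, G.Adj (f u) (f v) → G.Adj u v := by
    intro u v huv
    obtain ⟨x, hx⟩ := φ.surjective (.inr ⟨s(f u, f v), huv⟩)
    rcases x with x | e
    · rw [hf] at hx; cases hx
    · have hu : u ∈ (e : Sym2 V) := by
        rw [← hmem, ← middleGraph_adj_inl_inr, ← hh, hx]; simp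
      have hv : v ∈ (e : Sym2 V) := by
        rw [← hmem, ← middleGraph_adj_inl_inr, ← hh, hx]; simp
      have hne : u ≠ v := fun h => G.ne_of_adj huv (by rw [h])
      have := e.2
      rwa [(Sym2.mem_and_mem_iff hne).1 ⟨hu, hv⟩] at this
  refine ⟨⟨⟨f, g, hgf, hfg⟩, fun {u v} => ⟨hadj' u v, hadj u v⟩⟩, ?_⟩
  ext x
  rcases x with v | e
  · rw [hf]; rfl
  · rw [hh, middleGraphIso_inr]
    congr 1
    exact Subtype.ext (hmap e).symm

lemma middleGraphIso_eq_refl {σ : G ≃g G} (h : ∀ v, σ v = v) :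
    middleGraphIso σ = SimpleGraph.Iso.refl := by
  have : σ = SimpleGraph.Iso.refl := RelIso.ext h
  subst this
  ext x
  rcases x with v | e
  · rfl
  · rw [middleGraphIso_inr]
    refine congrArg Sum.inr (Subtype.ext ?_)
    exact congrFun Sym2.map_id _

end MiddleGraph

lemma distinguishingNumber_le {V : Type*} {G : SimpleGraph V} {d : ℕ} (c : V → Fin d)
    (hc : IsDistinguishingColoring G c) : distinguishingNumber G ≤ d :=
  iInf₂_le d ⟨c, hc⟩

lemma distinguishingIndex_le {V : Type*} {G : SimpleGraph V} {d : ℕ} (c : G.edgeSet → Fin d)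
    (hc : IsDistinguishingEdgeColoring G c) : distinguishingIndex G ≤ d :=
  iInf₂_le d ⟨c, hc⟩

/-! ### Breadth first search trees and automorphisms -/

namespace SimpleGraph

variable {V W : Type*} {G : SimpleGraph V} {r : V}

lemma Iso.dist_le {H : SimpleGraph W} (σ : G ≃g H) (hG : G.Connected) (u v : V) :
    H.dist (σ u) (σ v) ≤ G.dist u v := by
  obtain ⟨p, hp⟩ := hG.exists_walk_length_eq_dist u v
  rw [← hp, ← Walk.length_map σ.toHom p]
  exact H.dist_le _

lemma Iso.dist_apply_of_apply_eq {σ : G ≃g G} (hG : G.Connected) (hr : σ r = r) (x : V) :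
    G.dist r (σ x) = G.dist r x := by
  have h1 := σ.dist_le hG r x
  have h2 := σ.symm.dist_le hG r (σ x)
  rw [σ.symm_apply_apply, show σ.symm r = r by rw [← hr, σ.symm_apply_apply, hr]] at h2
  rw [hr] at h1
  exact le_antisymm h1 h2

lemma Connected.exists_adj_dist_add_one_eq (hG : G.Connected) {x : V} (hx : x ≠ r) :
    ∃ p, G.Adj p x ∧ G.dist r p + 1 = G.dist r x := by
  obtain ⟨w, hw⟩ := hG.exists_walk_length_eq_dist x r
  cases w with
  | nil => exact absurd rfl hx
  | @cons _ p _ h q =>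
    refine ⟨p, h.symm, le_antisymm ?_ ?_⟩
    · rw [dist_comm (v := x), ← hw, dist_comm, Walk.length_cons]
      exact Nat.add_le_add_right (G.dist_le q) 1
    · refine hG.dist_triangle.trans (Nat.add_le_add_left ?_ _)
      exact (dist_eq_one_iff_adj.2 h.symm).le

variable (G r) in
/-- The parent of `x` in a breadth first search tree of `G` rooted at `r`; the choice depends only
on the set of candidates. -/
noncomputable def bfsParent (x : V) : V :=
  @Classical.epsilon V ⟨r⟩ fun p => G.Adj p x ∧ G.dist r p + 1 = G.dist r x

lemma Connected.bfsParent_spec (hG : G.Connected) {x : V} (hx : x ≠ r) :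
    G.Adj (G.bfsParent r x) x ∧ G.dist r (G.bfsParent r x) + 1 = G.dist r x :=
  Classical.epsilon_spec (hG.exists_adj_dist_add_one_eq hx)

/-- Candidate parents lie one level nearer to `r`, hence are fixed by `σ`, so `x` and `σ x` have the
same candidates and the epsilon choice agrees. -/
lemma Connected.bfsParent_apply_of_fixed (hG : G.Connected) {σ : G ≃g G} (hr : σ r = r) {x : V}
    (h : ∀ y, G.dist r y < G.dist r x → σ y = y) : G.bfsParent r (σ x) = G.bfsParent r x := by
  unfold bfsParent
  congr 1
  funext p
  rw [Iso.dist_apply_of_apply_eq hG hr]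
  refine propext (and_congr_left fun hp => ?_)
  nth_rw 1 [← h p (by omega)]
  exact σ.map_adj_iff

/-- If an automorphism fixing the root fixes all children of `p` as soon as it fixes `p` and
permutes these children, then it is trivial. -/
lemma Connected.eq_of_fixes_children (hG : G.Connected) {σ : G ≃g G} (hr : σ r = r)
    (h : ∀ p, (∀ x ≠ r, G.bfsParent r x = p → G.bfsParent r (σ x) = p) → σ p = p →
      ∀ x ≠ r, G.bfsParent r x = p → σ x = x) (x : V) : σ x = x := by
  induction hn : G.dist r x using Nat.strong_induction_on generalizing x with
  | _ n ih =>
    by_cases hx : x = r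
    · rw [hx, hr]
    have hp := (hG.bfsParent_spec hx).2
    refine h (G.bfsParent r x) (fun y hy hyp => ?_) (ih _ (by omega) _ rfl) x hx rfl
    rw [hG.bfsParent_apply_of_fixed hr, hyp]
    intro z hz
    have := (hG.bfsParent_spec hy).2
    rw [hyp] at this
    exact ih _ (by omega) z rfl

/-- Otherwise 2|E| ≤ |V| ≤ |E| + 1, which forces |V| ≤ 2. -/
lemma Connected.exists_two_le_degree [Fintype V] [DecidableRel G.Adj] (hG : G.Connected)
    (h : 3 ≤ Fintype.card V) : ∃ r, 2 ≤ G.degree r := by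
  classical
  by_contra! hd
  have hs := G.sum_degrees_eq_twice_card_edges
  have hle : ∑ v, G.degree v ≤ ∑ _v : V, 1 := Finset.sum_le_sum fun v _ => by have := hd v; omega
  have hc := hG.card_vert_le_card_edgeSet_add_one
  rw [Nat.card_eq_fintype_card, Nat.card_eq_fintype_card, ← edgeFinset_card] at hc
  simp at hle
  omega

end SimpleGraph

/-! ### The distinguishing number -/

theorem distinguishingNumber_middleGraph_le {V : Type*} [Fintype V] {G : SimpleGraph V}
    [DecidableRel G.Adj] (hG : G.Connected) (hV : 3 ≤ Fintype.card V) :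
    distinguishingNumber (middleGraph G) ≤ (G.maxDegree : ℕ∞) := by
  classical
  obtain ⟨r, hr2⟩ := hG.exists_two_le_degree hV
  have hΔ : 2 ≤ G.maxDegree := hr2.trans (G.degree_le_maxDegree r)
  have hcol : ∀ p, ∃ f : V → Fin G.maxDegree, Set.InjOn f (G.neighborFinset p) := by
    intro p
    obtain ⟨g⟩ := Function.Embedding.nonempty_of_card_le (α := G.neighborFinset p)
      (β := Fin G.maxDegree) (by
        rw [Fintype.card_coe, Fintype.card_fin, card_neighborFinset_eq_degree]
        exact G.degree_le_maxDegree p)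
    refine ⟨fun x => if h : x ∈ G.neighborFinset p then g ⟨x, h⟩ else ⟨0, by omega⟩, ?_⟩
    intro x hx y hy hxy
    rw [Finset.mem_coe] at hx hy
    simp only [hx, hy, dif_pos] at hxy
    exact congrArg Subtype.val (g.injective hxy)
  choose f hf using hcol
  refine distinguishingNumber_le
    (Sum.elim (fun x => f (G.bfsParent r x) x)
      fun e => if r ∈ (e : Sym2 V) then ⟨1, by omega⟩ else ⟨0, by omega⟩) ?_
  intro φ hφ
  obtain ⟨σ, rfl⟩ := middleGraphIso_surjective φ
  apply middleGraphIso_eq_refl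
  have hstar : ∀ x, G.Adj r x → r = σ r ∨ r = σ x := by
    intro x hx
    have := hφ (.inr ⟨s(r, x), hx⟩)
    by_contra hcon
    simp [hcon] at this
  have hr : σ r = r := by
    -- Two edges at `r` have only `r` in common; if `r` moved, both `a` and `b` would be sent to
    -- `r`.
    obtain ⟨a, ha, b, hb, hab⟩ := Finset.one_lt_card.1 (show 1 < (G.neighborFinset r).card from hr2)
    rw [mem_neighborFinset] at ha hb
    by_contra hne
    have h1 := (hstar a ha).resolve_left (Ne.symm hne)
    have h2 := (hstar b hb).resolve_left (Ne.symm hne)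
    exact hab (σ.injective (h1.symm.trans h2))
  refine hG.eq_of_fixes_children hr fun p hp _ x hx hxp => ?_
  have hσx : σ x ≠ r := fun h => hx (σ.injective (h.trans hr.symm))
  have hc := hφ (.inl x)
  simp only [middleGraphIso_inl, Sum.elim_inl, hp x hx hxp, hxp] at hc
  refine hf p ?_ ?_ hc
  · have := (hG.bfsParent_spec hσx).1
    rw [hp x hx hxp] at this
    simpa using this
  · have := (hG.bfsParent_spec hx).1
    rw [hxp] at this
    simpa using this

/-- The rotation by 1 is nontrivial and preserves every coloring with at most one color. -/
theorem distinguishingNumber_middleGraph_cycleGraph (n : ℕ) :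
    distinguishingNumber (middleGraph (cycleGraph (n + 3))) =
      ((cycleGraph (n + 3)).maxDegree : ℕ∞) := by
  have hΔ : (cycleGraph (n + 3)).maxDegree = 2 := by
    refine le_antisymm (maxDegree_le_of_forall_degree_le _ _ fun v =>
      cycleGraph_degree_three_le.le) ?_
    rw [← cycleGraph_degree_three_le (v := (0 : Fin (n + 3)))]
    exact degree_le_maxDegree _ _
  refine le_antisymm (distinguishingNumber_middleGraph_le cycleGraph_connected (by simp)) ?_
  rw [hΔ]
  refine le_iInf₂ fun d hd => ?_
  obtain ⟨c, hc⟩ := hd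
  by_contra! hlt
  have hd1 : d ≤ 1 := by
    have : d < 2 := by exact_mod_cast hlt
    omega
  have : Subsingleton (Fin d) := Fin.subsingleton_iff_le_one.2 hd1
  let σ : cycleGraph (n + 3) ≃g cycleGraph (n + 3) :=
    ⟨Equiv.addRight 1, fun {a b} => by
      rw [cycleGraph_eq_circulantGraph]; exact circulantGraph_adj_translate⟩
  have h := hc (middleGraphIso σ) fun _ => Subsingleton.elim _ _
  have h0 := Sum.inl.inj (congrArg (fun φ : middleGraph (cycleGraph (n + 3)) ≃g _ => φ (.inl 0)) h)
  have h1 : (0 : Fin (n + 3)) + 1 = 0 := h0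
  simp at h1

/-! ### The distinguishing index -/

section DistinguishingIndex

variable {V : Type*} {G : SimpleGraph V} {r : V}

/-- Otherwise `x` and `y` would be parents of each other, against the distances to `r`. -/
lemma SimpleGraph.Connected.eq_of_bfsEdge_eq (hG : G.Connected) {x y : V} (hx : x ≠ r) (hy : y ≠ r)
    (h : s(G.bfsParent r x, x) = s(G.bfsParent r y, y)) : x = y := by
  rcases Sym2.eq_iff.1 h with h | ⟨h1, h2⟩
  · exact h.2
  · have hdx := (hG.bfsParent_spec hx).2
    have hdy := (hG.bfsParent_spec hy).2
    rw [h1] at hdx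
    rw [← h2] at hdy
    omega

variable [LinearOrder V]

variable (G r) in
/-- `x` is the least child of its parent in the breadth first search tree. -/
def IsFirstChild (x : V) : Prop :=
  x ≠ r ∧ ∀ z ≠ r, G.bfsParent r z = G.bfsParent r x → x ≤ z

variable (G r) in
/-- `y` is the child that follows `x` among the children of their common parent. -/
def IsNextSibling (x y : V) : Prop :=
  x ≠ r ∧ y ≠ r ∧ G.bfsParent r y = G.bfsParent r x ∧ x < y ∧
    ∀ z ≠ r, G.bfsParent r z = G.bfsParent r x → x < z → y ≤ z

variable (G r) in
/-- The edges of the middle graph that encode the order on the children of each vertex. -/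
def IsOrderEdge (s : Sym2 (V ⊕ G.edgeSet)) : Prop :=
  (∃ (x : V) (e : G.edgeSet), IsFirstChild G r x ∧ (e : Sym2 V) = s(G.bfsParent r x, x) ∧
    s = s(.inl x, .inr e)) ∨
  ∃ (x y : V) (e f : G.edgeSet), IsNextSibling G r x y ∧ (e : Sym2 V) = s(G.bfsParent r x, x) ∧
    (f : Sym2 V) = s(G.bfsParent r y, y) ∧ s = s(.inr e, .inr f)

open Classical in
variable (G r) in
/-- A 3-coloring of the edges of the middle graph: colour 2 marks the root, and colour 1 the edges
that encode the order on siblings. -/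
noncomputable def bfsEdgeColoring (e : (middleGraph G).edgeSet) : Fin 3 :=
  if .inl r ∈ (e : Sym2 (V ⊕ G.edgeSet)) then 2 else if IsOrderEdge G r e then 1 else 0

lemma bfsEdgeColoring_eq_two_iff {e : (middleGraph G).edgeSet} :
    bfsEdgeColoring G r e = 2 ↔ .inl r ∈ (e : Sym2 (V ⊕ G.edgeSet)) := by
  unfold bfsEdgeColoring
  split_ifs <;> simp_all

lemma bfsEdgeColoring_eq_one_iff {e : (middleGraph G).edgeSet} :
    bfsEdgeColoring G r e = 1 ↔ IsOrderEdge G r e := by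
  unfold bfsEdgeColoring
  split_ifs with h1
  -- No order edge contains the root, so giving color 2 priority hides none of them.
  · refine iff_of_false (by decide) ?_
    rintro (⟨x, e', hx, -, hs⟩ | ⟨x, y, e', f, -, -, -, hs⟩)
    · rw [hs] at h1
      simp only [Sym2.mem_iff, Sum.inl.injEq, reduceCtorEq, or_false] at h1
      exact hx.1 h1.symm
    · rw [hs] at h1
      simp at h1
  · exact iff_of_true rfl ‹_›
  · exact iff_of_false (by decide) ‹_›

lemma root_fixed_of_preserves {σ : G ≃g G}
    (hσ : ∀ e, bfsEdgeColoring G r ((middleGraphIso σ).mapEdgeSet e) = bfsEdgeColoring G r e)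
    {x : V} (hx : G.Adj r x) : σ r = r := by
  have hadj : (middleGraph G).Adj (.inl r) (.inr ⟨s(r, x), hx⟩) := by simp
  have h := (bfsEdgeColoring_eq_two_iff (r := r)
    (e := ⟨s(.inl r, .inr ⟨s(r, x), hx⟩), hadj⟩)).2 (Sym2.mem_mk_left _ _)
  rw [← hσ, bfsEdgeColoring_eq_two_iff, coe_mapEdgeSet, Sym2.map_mk, Sym2.mem_iff] at h
  rcases h with h | h
  · exact (Sum.inl.inj h).symm
  · cases h

lemma isOrderEdge_map_of_preserves {σ : G ≃g G}
    (hσ : ∀ e, bfsEdgeColoring G r ((middleGraphIso σ).mapEdgeSet e) = bfsEdgeColoring G r e)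
    {a b : V ⊕ G.edgeSet} (hab : (middleGraph G).Adj a b) (h : IsOrderEdge G r s(a, b)) :
    IsOrderEdge G r s(middleGraphIso σ a, middleGraphIso σ b) := by
  have h' := (bfsEdgeColoring_eq_one_iff (e := ⟨s(a, b), hab⟩)).2 h
  rwa [← hσ, bfsEdgeColoring_eq_one_iff] at h'

/-- Among order edges, only those tagging a first child have an end in `V`. -/
lemma IsFirstChild.apply_of_preserves (hG : G.Connected) {σ : G ≃g G}
    (hσ : ∀ e, bfsEdgeColoring G r ((middleGraphIso σ).mapEdgeSet e) = bfsEdgeColoring G r e)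
    {x : V} (hx : IsFirstChild G r x) : IsFirstChild G r (σ x) := by
  have hE := (hG.bfsParent_spec hx.1).1
  have := isOrderEdge_map_of_preserves hσ (a := .inl x) (b := .inr ⟨s(G.bfsParent r x, x), hE⟩) (by simp)
    (.inl ⟨x, ⟨s(G.bfsParent r x, x), hE⟩, hx, rfl, rfl⟩)
  rcases this with ⟨y, e, hy, -, h⟩ | ⟨y, z, e, f, -, -, -, h⟩
  · simp only [middleGraphIso_inl, middleGraphIso_inr, Sym2.eq_iff, Sum.inl.injEq, Sum.inr.injEq,
      reduceCtorEq, and_self, or_false] at h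
    rwa [h.1]
  · simp at h

/-- Edges are unordered, so the color shows that `x` and `σ y` are consecutive but not which comes
first. -/
lemma IsNextSibling.apply_of_preserves (hG : G.Connected) {σ : G ≃g G}
    (hσ : ∀ e, bfsEdgeColoring G r ((middleGraphIso σ).mapEdgeSet e) = bfsEdgeColoring G r e)
    {x y : V} (h : IsNextSibling G r x y) (hσx : σ x = x)
    (hp : σ (G.bfsParent r x) = G.bfsParent r x) (hσy : σ y ≠ r)
    (hpy : G.bfsParent r (σ y) = G.bfsParent r x) :
    IsNextSibling G r x (σ y) ∨ IsNextSibling G r (σ y) x := by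
  have hx := (hG.bfsParent_spec h.1).1
  have hy := (hG.bfsParent_spec h.2.1).1
  have hadj : (middleGraph G).Adj (.inr ⟨s(G.bfsParent r x, x), hx⟩) (.inr ⟨s(G.bfsParent r y, y), hy⟩) := by
    refine ⟨fun he => h.2.2.2.1.ne ?_, G.bfsParent r x, Sym2.mem_mk_left _ _, ?_⟩
    · exact hG.eq_of_bfsEdge_eq h.1 h.2.1 (congrArg Subtype.val he)
    · rw [← h.2.2.1]; exact Sym2.mem_mk_left _ _
  have hmx : (σ.mapEdgeSet ⟨s(G.bfsParent r x, x), hx⟩ : Sym2 V) = s(G.bfsParent r x, x) := by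
    rw [coe_mapEdgeSet, Sym2.map_mk, hp, hσx]
  have hmy : (σ.mapEdgeSet ⟨s(G.bfsParent r y, y), hy⟩ : Sym2 V) = s(G.bfsParent r (σ y), σ y) := by
    rw [coe_mapEdgeSet, Sym2.map_mk, h.2.2.1, hp, hpy]
  have := isOrderEdge_map_of_preserves hσ hadj (.inr ⟨x, y, _, _, h, rfl, rfl, rfl⟩)
  rcases this with ⟨a, e, -, -, hs⟩ | ⟨a, b, e, f, hab, he, hf, hs⟩
  · simp at hs
  · rw [middleGraphIso_inr, middleGraphIso_inr, Sym2.eq_iff] at hs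
    rcases hs with ⟨h1, h2⟩ | ⟨h1, h2⟩
    · have h1 := congrArg Subtype.val (Sum.inr.inj h1)
      have h2 := congrArg Subtype.val (Sum.inr.inj h2)
      rw [hmx, he] at h1
      rw [hmy, hf] at h2
      rw [hG.eq_of_bfsEdge_eq h.1 hab.1 h1, hG.eq_of_bfsEdge_eq hσy hab.2.1 h2]
      exact .inl hab
    · have h1 := congrArg Subtype.val (Sum.inr.inj h1)
      have h2 := congrArg Subtype.val (Sum.inr.inj h2)
      rw [hmx, hf] at h1
      rw [hmy, he] at h2
      rw [hG.eq_of_bfsEdge_eq h.1 hab.2.1 h1, hG.eq_of_bfsEdge_eq hσy hab.1 h2]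
      exact .inr hab

lemma exists_isNextSibling_of_not_isFirstChild [Finite V] {x : V} (hx : x ≠ r)
    (h : ¬ IsFirstChild G r x) : ∃ y, IsNextSibling G r y x := by
  unfold IsFirstChild at h
  push Not at h
  obtain ⟨z, hz⟩ := h hx
  obtain ⟨y, ⟨hy, hyx, hlt⟩, hmax⟩ := (Set.toFinite
    {z | z ≠ r ∧ G.bfsParent r z = G.bfsParent r x ∧ z < x}).exists_maximal ⟨z, hz⟩
  refine ⟨y, hy, hx, hyx.symm, hlt, fun w hw hwy hyw => ?_⟩
  by_contra! hwx
  exact absurd (hmax ⟨hw, hwy.trans hyx, hwx⟩ hyw.le) hyw.not_ge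

theorem isDistinguishingEdgeColoring_bfsEdgeColoring [Finite V] (hG : G.Connected) :
    IsDistinguishingEdgeColoring (middleGraph G) (bfsEdgeColoring G r) := by
  intro φ hφ
  obtain ⟨σ, rfl⟩ := middleGraphIso_surjective φ
  apply middleGraphIso_eq_refl
  have hr : σ r = r := by
    -- With a single vertex no edge has color 2, but the root is trivially fixed.
    by_cases h : ∃ x, x ≠ r
    · obtain ⟨x, hx⟩ := h
      have : Nontrivial V := ⟨x, r, hx⟩
      obtain ⟨y, hy⟩ := hG.preconnected.exists_adj_of_nontrivial r
      exact root_fixed_of_preserves hφ hy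
    · push Not at h
      exact h _
  have hne : ∀ {x}, x ≠ r → σ x ≠ r := fun hx h => hx (σ.injective (h.trans hr.symm))
  refine hG.eq_of_fixes_children hr fun p hp hσp x => ?_
  induction x using WellFoundedLT.induction with
  | _ x ih =>
    intro hx hxp
    by_cases hfirst : IsFirstChild G r x
    · have hfirst' := hfirst.apply_of_preserves hG hφ
      have hpar := (hp x hx hxp).trans hxp.symm
      exact le_antisymm (hfirst'.2 x hx hpar.symm) (hfirst.2 _ (hne hx) hpar)
    · obtain ⟨y, hyx⟩ := exists_isNextSibling_of_not_isFirstChild hx hfirst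
      have hyp : G.bfsParent r y = p := hyx.2.2.1.symm.trans hxp
      have hσx := (hp x hx hxp).trans hyp.symm
      have hσy := ih y hyx.2.2.2.1 hyx.1 hyp
      rcases hyx.apply_of_preserves hG hφ hσy (by rw [hyp, hσp]) (hne hx) hσx with h | h
      · exact le_antisymm (h.2.2.2.2 x hx hyx.2.2.1 hyx.2.2.2.1)
          (hyx.2.2.2.2 _ (hne hx) hσx h.2.2.2.1)
      -- Here `σ x < y < x`, so `σ` already fixes `σ x`, and injectivity gives `σ x = x`.
      · exact σ.injective (ih _ (h.2.2.2.1.trans hyx.2.2.2.1) (hne hx) (hσx.trans hyp))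

end DistinguishingIndex

theorem distinguishingIndex_middleGraph_le {V : Type*} [Finite V] {G : SimpleGraph V}
    (hG : G.Connected) : distinguishingIndex (middleGraph G) ≤ 3 := by
  obtain ⟨r⟩ := hG.nonempty
  let e := Finite.equivFin V
  let _ : LinearOrder V := LinearOrder.lift' e e.injective
  exact distinguishingIndex_le _ (isDistinguishingEdgeColoring_bfsEdgeColoring (r := r) hG)

theorem theorem3p6 :
    (∀ (V : Type*) [Fintype V] (G : SimpleGraph V) [DecidableRel G.Adj],
      G.Connected → 3 ≤ Fintype.card V →
        distinguishingNumber (middleGraph G) ≤ (G.maxDegree : ℕ∞)) ∧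
    (∀ n : ℕ, 3 ≤ n → ∃ (H : SimpleGraph (Fin n)) (_ : DecidableRel H.Adj),
      H.Connected ∧ distinguishingNumber (middleGraph H) = (H.maxDegree : ℕ∞)) ∧
    (∀ (V : Type*) [Fintype V] (G : SimpleGraph V),
      G.Connected → distinguishingIndex (middleGraph G) ≤ 3) := by
  refine ⟨fun V _ G _ hG hV => distinguishingNumber_middleGraph_le hG hV, fun n hn => ?_,
    fun V _ G hG => distinguishingIndex_middleGraph_le hG⟩
  obtain ⟨n, rfl⟩ := Nat.exists_eq_add_of_le' hn
  exact ⟨cycleGraph (n + 3), inferInstance, cycleGraph_connected,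
    distinguishingNumber_middleGraph_cycleGraph n⟩
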